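/- Let $d\in\{2,3\}$. For $K,R\in\mathbb{N}$ with $K\ge 1$ put $h=\pi/K$ and $$\Omega=\{x\in h\mathbb{Z}^d:\ -\pi R\le x_j\le \pi R,\ j=1,\dots,d\},\qquad \partial\Omega=\{x\in\Omega:\ x_j=\pm\pi R\text{ for some }j\}.$$ Let $L^2(\Omega)$ be the space of functions $f:\Omega\to\mathbb{C}$ with $f|_{\partial\Omega}=0$, with the norm $\|f\|_{L^2(\Omega)}=\big(h^d\sum_{x\in\Omega}|f(x)|^2\big)^{1/2}$. On $L^2(\Omega)$ let $\Delta_\Omega$ be the self-adjoint discrete Laplacian $$\Delta_\Omega f(x)=\frac1{h^2}\sum_{j=1}^d\big(f(x+h\mathbf{e}_j)+f(x-h\mathbf{e}_j)-2f(x)\big)\ \ (x\in\Omega\setminus\partial\Omega),\qquad \Delta_\Omega f(x)=0\ \ (x\in\partial\Omega),$$ and put $\|f\|_{H^{1,1}(\Omega)}=\big(\|\sqrt{1-\Delta_\Omega}\,f\|_{L^2(\Omega)}^2+\|xf\|_{L^2(\Omega)}^2\big)^{1/2}$. There is a function $c:\mathbb{R}\to(0,\infty)$ such that for each $d\in\{2,3\}$,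 $\alpha>0$ and $A\ge1$ there is a constant $C>0$, depending only on $d$, $\alpha$ and $A$, with the following property. Let $K\ge1$ and $R$ be natural numbers with $h=\pi/K\in(0,1]$ and $A^{-1}h^{-\alpha}\le R\le A h^{-\alpha}$ (that is, $R\sim h^{-\alpha}$), let $w_0:\Omega\to\mathbb{C}$ vanish on $\partial\Omega$, and let $w:\mathbb{R}\times\Omega\to\mathbb{C}$, with $w(t,\cdot)|_{\partial\Omega}=0$, be the global solution of the discrete nonlinear Schrödinger equation $$i\partial_t w+\Delta_\Omega w-|w|^2w=0,\qquad w(0)=w_0 .$$ Then, with $c=c\big(\|w_0\|_{H^{1,1}(\Omega)}\big)$, $$\|x\,w(t)\|_{L^2(\Omega)}\le C\,\|w_0\|_{H^{1,1}(\Omega)}\,e^{c|t|}\qquad\text{for all }t\in\mathbb{R}.$$ In particular, $C$ and $c$ do not depend on $h$. -/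

import Mathlib

noncomputable section

namespace LatticeNLS

/-- The mesh size `h = π / K`. -/
def mesh (K : ℕ) : ℝ := Real.pi / K

/-- The index set of the lattice `Ω`: all `m ∈ ℤ^d` with `-KR ≤ m_j ≤ KR` for every `j`.
The index `m` stands for the point `x = h m`. -/
def indexSet (d K R : ℕ) : Finset (Fin d → ℤ) :=
  Fintype.piFinset fun _ => Finset.Icc (-((K : ℤ) * R)) ((K : ℤ) * R)

/-- The finite cubic lattice `Ω = {x ∈ hℤ^d : -πR ≤ x_j ≤ πR}`, given by its index set. -/
abbrev Omega (d K R : ℕ) : Type := {m : Fin d → ℤ // m ∈ indexSet d K R}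

variable {d K R : ℕ}

/-- The point `x = h m` of `ℝ^d` with index `m`. -/
def point (x : Omega d K R) : EuclideanSpace ℝ (Fin d) :=
  WithLp.toLp 2 fun j => mesh K * (x.1 j : ℝ)

/-- The boundary of `Ω`: some coordinate is `±πR`, that is, `m_j = ±KR`. -/
def IsBoundary (x : Omega d K R) : Prop :=
  ∃ j, x.1 j = (K : ℤ) * R ∨ x.1 j = -((K : ℤ) * R)

/-- The subspace of `ℂ^Ω` of all functions `f : Ω → ℂ` with zero boundary values. -/
def zeroBoundary (d K R : ℕ) : Submodule ℂ (EuclideanSpace ℂ (Omega d K R)) where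
  carrier := {f | ∀ x, IsBoundary x → f x = 0}
  add_mem' := by
    intro f g hf hg x hx
    simp [hf x hx, hg x hx]
  zero_mem' := by
    intro x _
    simp
  smul_mem' := by
    intro a f hf x hx
    simp [hf x hx]

/-- The space `L²(Ω)` of functions `f : Ω → ℂ` with zero boundary values. It carries the inner
product inherited from `ℂ^Ω`, without the factor `h^d`; this factor changes neither adjoints nor
the functional calculus of operators, and it is present in the norm `l2Norm` below. -/
def L2 (d K R : ℕ) : Type := zeroBoundary d K R

instance : NormedAddCommGroup (L2 d K R) := inferInstanceAs (NormedAddCommGroup (zeroBoundary d K R))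

instance : InnerProductSpace ℂ (L2 d K R) :=
  inferInstanceAs (InnerProductSpace ℂ (zeroBoundary d K R))

instance : FiniteDimensional ℂ (L2 d K R) :=
  inferInstanceAs (FiniteDimensional ℂ (zeroBoundary d K R))

instance : CompleteSpace (L2 d K R) := FiniteDimensional.complete ℂ (L2 d K R)

/-- Elements of `L²(Ω)` are functions on `Ω`. -/
instance : CoeFun (L2 d K R) fun _ => Omega d K R → ℂ := ⟨fun f x => f.1 x⟩

/-- The element of `L²(Ω)` given by a function with zero boundary values. -/
def L2.mk (f : Omega d K R → ℂ) (hf : ∀ x, IsBoundary x → f x = 0) : L2 d K R :=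
  ⟨WithLp.toLp 2 f, hf⟩

theorem L2.mk_apply (f : Omega d K R → ℂ) (hf : ∀ x, IsBoundary x → f x = 0) (x : Omega d K R) :
    L2.mk f hf x = f x := rfl

theorem L2.add_apply (f g : L2 d K R) (x : Omega d K R) : (f + g) x = f x + g x := rfl

theorem L2.smul_apply (a : ℂ) (f : L2 d K R) (x : Omega d K R) : (a • f) x = a * f x := rfl

theorem L2.ext {f g : L2 d K R} (h : ∀ x, f x = g x) : f = g :=
  Subtype.ext (PiLp.ext h)

/-- Extension by zero of a function on `Ω` to the whole lattice `hℤ^d` (indexed by `ℤ^d`). -/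
def extend (f : L2 d K R) (m : Fin d → ℤ) : ℂ :=
  if hm : m ∈ indexSet d K R then f ⟨m, hm⟩ else 0

open Classical in
/-- The values of the discrete Laplacian: the second difference quotient at the points of
`Ω \ ∂Ω` (all neighbours of such a point lie in `Ω`), and zero on `∂Ω`. -/
def laplacianFun (f : L2 d K R) (x : Omega d K R) : ℂ :=
  if IsBoundary x then 0
  else (1 / ((mesh K : ℝ) : ℂ) ^ 2) * ∑ j : Fin d,
    (extend f (x.1 + Pi.single j 1) + extend f (x.1 - Pi.single j 1) - 2 * f x)

theorem extend_add (f g : L2 d K R) (m : Fin d → ℤ) :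
    extend (f + g) m = extend f m + extend g m := by
  unfold extend
  split_ifs
  · exact L2.add_apply f g _
  · simp

theorem extend_smul (a : ℂ) (f : L2 d K R) (m : Fin d → ℤ) :
    extend (a • f) m = a * extend f m := by
  unfold extend
  split_ifs
  · exact L2.smul_apply a f _
  · simp

theorem laplacianFun_boundary (f : L2 d K R) (x : Omega d K R) (hx : IsBoundary x) :
    laplacianFun f x = 0 := by
  simp [laplacianFun, hx]

/-- The discrete Laplacian `Δ_Ω` as a (bounded) linear operator on `L²(Ω)`. -/
def laplacian (d K R : ℕ) : L2 d K R →L[ℂ] L2 d K R :=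
  LinearMap.toContinuousLinearMap
    { toFun := fun f => L2.mk (laplacianFun f) (laplacianFun_boundary f)
      map_add' := by
        intro f g
        refine L2.ext fun x => ?_
        rw [L2.add_apply, L2.mk_apply, L2.mk_apply, L2.mk_apply]
        by_cases hx : IsBoundary x
        · simp [laplacianFun, hx]
        · simp only [laplacianFun, hx, if_false, extend_add, L2.add_apply,
            ← mul_add, ← Finset.sum_add_distrib]
          congr 1
          exact Finset.sum_congr rfl fun j _ => by ring
      map_smul' := by
        intro a f
        refine L2.ext fun x => ?_
        rw [RingHom.id_apply, L2.smul_apply, L2.mk_apply, L2.mk_apply]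
        by_cases hx : IsBoundary x
        · simp [laplacianFun, hx]
        · simp only [laplacianFun, hx, if_false, extend_smul, L2.smul_apply, Finset.mul_sum]
          exact Finset.sum_congr rfl fun j _ => by ring }

/-- The norm `‖f‖_{L²(Ω)} = (h^d ∑_{x ∈ Ω} |f(x)|²)^{1/2}`. -/
def l2Norm (f : L2 d K R) : ℝ :=
  Real.sqrt (mesh K ^ d * ∑ x : Omega d K R, ‖f x‖ ^ 2)

/-- The weighted norm `‖x f‖_{L²(Ω)} = (h^d ∑_{x ∈ Ω} |x|² |f(x)|²)^{1/2}`. -/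
def weightedL2Norm (f : L2 d K R) : ℝ :=
  Real.sqrt (mesh K ^ d * ∑ x : Omega d K R,
    (‖point x‖ * ‖f x‖) ^ 2)

/-- The operator `(1 - Δ_Ω)^{1/2}`, the positive square root of the positive operator
`1 - Δ_Ω` on the Hilbert space `L²(Ω)`. -/
def sqrtOneSubLaplacian (d K R : ℕ) : L2 d K R →L[ℂ] L2 d K R :=
  CFC.sqrt (1 - laplacian d K R)

/-- The norm `‖f‖_{H^1(Ω)} = ‖(1 - Δ_Ω)^{1/2} f‖_{L²(Ω)}`. -/
def h1Norm (f : L2 d K R) : ℝ := l2Norm (sqrtOneSubLaplacian d K R f)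

/-- The norm `‖f‖_{H^{1,1}(Ω)} = (‖(1 - Δ_Ω)^{1/2} f‖² + ‖x f‖²)^{1/2}`, with norms in `L²(Ω)`. -/
def h11Norm (f : L2 d K R) : ℝ := Real.sqrt (h1Norm f ^ 2 + weightedL2Norm f ^ 2)

/-- `w : ℝ × Ω → ℂ` (with zero boundary values at each time) is a global solution of
`i ∂_t w + Δ_Ω w - |w|² w = 0`, `w(0) = w₀`. -/
structure IsGlobalSolution (w₀ : L2 d K R) (w : ℝ → L2 d K R) : Prop where
  initial : w 0 = w₀
  differentiable : Differentiable ℝ w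
  equation : ∀ (t : ℝ) (x : Omega d K R),
    Complex.I * deriv w t x + laplacian d K R (w t) x - ((‖w t x‖ ^ 2 : ℝ) : ℂ) * w t x = 0

end LatticeNLS

end

/-!
The proof combines a virial estimate with the conserved energy; no Gronwall argument is needed.

Along a solution, `d/dt ‖x w‖² = -2 Im ⟨|x|² w, Δ w⟩`. Summation by parts
(`im_sum_weight_secondDiff`) moves a difference onto the weight, where
`|x + h e_j|² - |x|² = h (x_j + (x_j + h))`, and Cauchy–Schwarz gives
`|d/dt ‖x w‖²| ≤ 4 ‖x w‖ ‖∇w‖` exactly, without error terms in `h`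
(`abs_im_sum_weight_laplacian_le`). Hence `‖x w(t)‖` grows at most linearly, with a rate of twice
the supremum of `‖∇w‖` (`sqrt_le_add_mul_abs`).

As the nonlinearity is defocusing, `‖∇w(t)‖²` is at most twice the energy, which is conserved
(`IsGlobalSolution.energy_eq`) and is controlled by the initial datum through the discrete
Ladyzhenskaya inequality `‖f‖_{L⁴}⁴ ≤ 4 ‖f‖_{H¹}⁴`, whose constant does not depend on `h`
(`sum_norm_pow_four_le`). In two dimensions this inequality follows by bounding `|f|²` by sums of
its differences along horizontal and vertical lines; in three dimensions, by applying the planar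
inequality on slices.

Altogether `‖x w(t)‖ ≤ ‖x w₀‖ + 2 (H + 2 H²) |t|` with `H = ‖w₀‖_{H¹}`, and the linear growth is
dominated by the exponential with `C = 4` and `c(N) = 1 + |N|`.

Functions on `Ω` are treated through their extension by zero to `ℤ^d`. Since they vanish on `∂Ω`,
all shifts and summations by parts over the cube are free of boundary terms (`sum_box_shift`).
-/

noncomputable section

namespace LatticeNLS

/-! ### Finite sums on the integer lattice -/

/-- The cube `{-N, …, N}^d` in `ℤ^d`; `indexSet d K R` is `box d (K * R)`. -/
abbrev box (d : ℕ) (N : ℤ) : Finset (Fin d → ℤ) :=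
  Fintype.piFinset fun _ => Finset.Icc (-N) N

/-- The function `f` on `ℤ^d` is zero outside the interior `{-N + 1, …, N - 1}^d` of `box d N`. -/
def SupportedInside {d : ℕ} {E : Type*} [Zero E] (N : ℤ) (f : (Fin d → ℤ) → E) : Prop :=
  ∀ m, f m ≠ 0 → ∀ j, -N < m j ∧ m j < N

/-- The forward difference `f(m + e_j) - f(m)`. -/
def forwardDiff {d : ℕ} (f : (Fin d → ℤ) → ℂ) (j : Fin d) (m : Fin d → ℤ) : ℂ :=
  f (m + Pi.single j 1) - f m

/-- The second difference `f(m + e_j) + f(m - e_j) - 2 f(m)`. -/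
def secondDiff {d : ℕ} (f : (Fin d → ℤ) → ℂ) (j : Fin d) (m : Fin d → ℤ) : ℂ :=
  f (m + Pi.single j 1) + f (m - Pi.single j 1) - 2 * f m

/-- The sum of `|f(m + e_j) - f(m)|²` over all directions `j` and all `m ∈ box d N`. -/
def gradSq {d : ℕ} (N : ℤ) (f : (Fin d → ℤ) → ℂ) : ℝ :=
  ∑ j, ∑ m ∈ box d N, ‖forwardDiff f j m‖ ^ 2

/-- The sum of `|m|² |f(m)|²` over `m ∈ box d N`, where `|m|` is the Euclidean length. -/
def momentSq {d : ℕ} (N : ℤ) (f : (Fin d → ℤ) → ℂ) : ℝ :=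
  ∑ m ∈ box d N, (∑ j, (m j : ℝ) ^ 2) * ‖f m‖ ^ 2

section

variable {d : ℕ} {N : ℤ}

theorem gradSq_nonneg (f : (Fin d → ℤ) → ℂ) : 0 ≤ gradSq N f := by
  unfold gradSq; positivity

theorem momentSq_nonneg (f : (Fin d → ℤ) → ℂ) : 0 ≤ momentSq N f := by
  unfold momentSq; positivity

theorem sum_box_shift {E : Type*} [AddCommMonoid E] {F : (Fin d → ℤ) → E}
    (hF : SupportedInside N F) (j : Fin d) :
    ∑ m ∈ box d N, F (m + Pi.single j 1) = ∑ m ∈ box d N, F m := by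
  rw [← finsum_eq_sum_of_support_subset F, ← finsum_eq_sum_of_support_subset]
  · exact finsum_comp_equiv (Equiv.addRight (Pi.single j (1 : ℤ) : Fin d → ℤ))
  · intro m hm
    simp only [Finset.mem_coe, Fintype.mem_piFinset, Finset.mem_Icc]
    intro i
    have := hF _ hm i
    by_cases h : i = j
    · subst h; simp at this; omega
    · simp [h] at this; omega
  · intro m hm
    simp only [Finset.mem_coe, Fintype.mem_piFinset, Finset.mem_Icc]
    intro i
    have := hF _ hm i
    omega

theorem SupportedInside.of_imp {E E' : Type*} [Zero E] [Zero E'] {f : (Fin d → ℤ) → E}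
    (hf : SupportedInside N f) {g : (Fin d → ℤ) → E'} (h : ∀ m, f m = 0 → g m = 0) :
    SupportedInside N g :=
  fun m hm => hf m fun h0 => hm (h m h0)

open ComplexConjugate in
/-- Discrete Green's formula in one direction; only one of the two functions has to vanish near
the boundary of the cube. -/
theorem sum_conj_mul_secondDiff {f g : (Fin d → ℤ) → ℂ} (hf : SupportedInside N f)
    (j : Fin d) :
    ∑ m ∈ box d N, conj (f m) * secondDiff g j m =
      -∑ m ∈ box d N, conj (forwardDiff f j m) * forwardDiff g j m := by
  have h1 : ∑ m ∈ box d N, conj (f (m + Pi.single j 1)) * g (m + Pi.single j 1) =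
      ∑ m ∈ box d N, conj (f m) * g m :=
    sum_box_shift (F := fun m => conj (f m) * g m) (hf.of_imp fun m h => by simp [h]) j
  have h2 : ∑ m ∈ box d N, conj (f (m + Pi.single j 1)) * g m =
      ∑ m ∈ box d N, conj (f m) * g (m - Pi.single j 1) := by
    have := sum_box_shift (F := fun m => conj (f m) * g (m - Pi.single j 1))
      (hf.of_imp fun m h => by simp [h]) j
    simpa using this
  have h3 : ∑ m ∈ box d N, conj (forwardDiff f j m) * forwardDiff g j m =
      ∑ m ∈ box d N, conj (f (m + Pi.single j 1)) * g (m + Pi.single j 1)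
      - ∑ m ∈ box d N, conj (f (m + Pi.single j 1)) * g m
      - ∑ m ∈ box d N, conj (f m) * g (m + Pi.single j 1)
      + ∑ m ∈ box d N, conj (f m) * g m := by
    simp only [← Finset.sum_add_distrib, ← Finset.sum_sub_distrib]
    refine Finset.sum_congr rfl fun m _ => ?_
    simp only [forwardDiff, map_sub]; ring
  rw [h3, h1, h2]
  simp only [← Finset.sum_add_distrib, ← Finset.sum_sub_distrib, ← Finset.sum_neg_distrib]
  refine Finset.sum_congr rfl fun m _ => ?_
  simp only [secondDiff]; ring

/-! ### The commutator of the Laplacian with the weight -/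

open ComplexConjugate in
/-- The current `Im (ā b)` depends on the difference `b - a` only, and the other factor may be
taken at either endpoint. -/
theorem abs_im_conj_mul_le (a b : ℂ) :
    |(conj a * b).im| ≤ ‖a‖ * ‖b - a‖ ∧ |(conj a * b).im| ≤ ‖b‖ * ‖b - a‖ := by
  constructor
  · have h : (conj a * b).im = (conj a * (b - a)).im := by simp; ring
    rw [h, ← Complex.norm_conj a, ← norm_mul]
    exact Complex.abs_im_le_norm _
  · have h : (conj a * b).im = (-(b * conj (b - a))).im := by simp; ring
    rw [h, ← Complex.norm_conj (b - a), ← norm_mul, ← norm_neg]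
    exact Complex.abs_im_le_norm _

theorem sum_single_shift_sq (m : Fin d → ℤ) (j : Fin d) :
    ∑ i, (((m + Pi.single j 1 : Fin d → ℤ) i : ℤ) : ℝ) ^ 2 = ∑ i, (m i : ℝ) ^ 2 + (2 * m j + 1) := by
  have h : ∀ i, (((m + Pi.single j 1 : Fin d → ℤ) i : ℤ) : ℝ) ^ 2 =
      (m i : ℝ) ^ 2 + if i = j then (2 * (m j : ℝ) + 1) else 0 := by
    intro i
    by_cases h : i = j
    · subst h; simp; ring
    · simp [h]
  rw [Finset.sum_congr rfl fun i _ => h i, Finset.sum_add_distrib]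
  simp

open ComplexConjugate in
/-- Summation by parts moves a difference onto the weight: only
`|m|² - |m + e_j|² = -(2 m_j + 1)` survives in the imaginary part. -/
theorem im_sum_weight_secondDiff {f : (Fin d → ℤ) → ℂ} (hf : SupportedInside N f) (j : Fin d) :
    (∑ m ∈ box d N, ((∑ i, (m i : ℝ) ^ 2 : ℝ) : ℂ) * (conj (f m) * secondDiff f j m)).im =
      -∑ m ∈ box d N, (2 * (m j : ℝ) + 1) * (conj (f m) * f (m + Pi.single j 1)).im := by
  set ρ : (Fin d → ℤ) → ℝ := fun m => ∑ i, (m i : ℝ) ^ 2 with hρ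
  have h2 : ∑ m ∈ box d N, ρ (m + Pi.single j 1) * (conj (f (m + Pi.single j 1)) * f m).im =
      ∑ m ∈ box d N, ρ m * (conj (f m) * f (m - Pi.single j 1)).im := by
    have := sum_box_shift (F := fun m => ρ m * (conj (f m) * f (m - Pi.single j 1)).im)
      (hf.of_imp fun m h => by simp [h]) j
    simpa only [add_sub_cancel_right] using this
  have h3 : (∑ m ∈ box d N, ((ρ m : ℝ) : ℂ) * (conj (f m) * secondDiff f j m)).im =
      ∑ m ∈ box d N, ρ m * (conj (f m) * f (m + Pi.single j 1)).im +
      ∑ m ∈ box d N, ρ m * (conj (f m) * f (m - Pi.single j 1)).im := by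
    rw [Complex.im_sum, ← Finset.sum_add_distrib]
    refine Finset.sum_congr rfl fun m _ => ?_
    rw [Complex.im_ofReal_mul, ← mul_add]
    congr 1
    simp [secondDiff]; ring
  rw [h3, ← h2, ← Finset.sum_add_distrib, ← Finset.sum_neg_distrib]
  refine Finset.sum_congr rfl fun m _ => ?_
  have : ρ (m + Pi.single j 1) = ρ m + (2 * m j + 1) := sum_single_shift_sq m j
  rw [this]
  simp; ring

open ComplexConjugate in
theorem abs_im_sum_weight_laplacian_le {f : (Fin d → ℤ) → ℂ} (hf : SupportedInside N f) :
    |(∑ m ∈ box d N, ((∑ i, (m i : ℝ) ^ 2 : ℝ) : ℂ) *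
      (conj (f m) * ∑ j, secondDiff f j m)).im| ≤
      2 * (√(momentSq N f) * √(gradSq N f)) := by
  have hmom : momentSq N f = ∑ p ∈ (Finset.univ : Finset (Fin d)) ×ˢ box d N,
      (|(p.2 p.1 : ℝ)| * ‖f p.2‖) ^ 2 := by
    rw [Finset.sum_product_right, momentSq]
    refine Finset.sum_congr rfl fun m _ => ?_
    rw [Finset.sum_mul]
    exact Finset.sum_congr rfl fun j _ => by rw [mul_pow, sq_abs]
  have hmom' : momentSq N f = ∑ p ∈ (Finset.univ : Finset (Fin d)) ×ˢ box d N,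
      (|(p.2 p.1 : ℝ) + 1| * ‖f (p.2 + Pi.single p.1 1)‖) ^ 2 := by
    rw [hmom, Finset.sum_product, Finset.sum_product]
    refine Finset.sum_congr rfl fun j _ => ?_
    rw [← sum_box_shift (F := fun m => (|(m j : ℝ)| * ‖f m‖) ^ 2)
      (hf.of_imp fun m h => by simp [h]) j]
    simp
  have hgrad : gradSq N f = ∑ p ∈ (Finset.univ : Finset (Fin d)) ×ˢ box d N,
      ‖forwardDiff f p.1 p.2‖ ^ 2 := by
    rw [Finset.sum_product, gradSq]
  have hA := Real.sum_mul_le_sqrt_mul_sqrt ((Finset.univ : Finset (Fin d)) ×ˢ box d N)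
    (fun p => |(p.2 p.1 : ℝ)| * ‖f p.2‖) (fun p => ‖forwardDiff f p.1 p.2‖)
  have hB := Real.sum_mul_le_sqrt_mul_sqrt ((Finset.univ : Finset (Fin d)) ×ˢ box d N)
    (fun p => |(p.2 p.1 : ℝ) + 1| * ‖f (p.2 + Pi.single p.1 1)‖)
    (fun p => ‖forwardDiff f p.1 p.2‖)
  rw [← hmom, ← hgrad] at hA
  rw [← hmom', ← hgrad] at hB
  have hsplit : (∑ m ∈ box d N, ((∑ i, (m i : ℝ) ^ 2 : ℝ) : ℂ) *
      (conj (f m) * ∑ j, secondDiff f j m)).im =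
      ∑ p ∈ (Finset.univ : Finset (Fin d)) ×ˢ box d N,
        -((2 * (p.2 p.1 : ℝ) + 1) * (conj (f p.2) * f (p.2 + Pi.single p.1 1)).im) := by
    simp only [Finset.mul_sum]
    rw [Finset.sum_comm, Complex.im_sum, Finset.sum_product]
    refine Finset.sum_congr rfl fun j _ => ?_
    rw [im_sum_weight_secondDiff hf j, Finset.sum_neg_distrib]
  rw [hsplit]
  refine (Finset.abs_sum_le_sum_abs _ _).trans ?_
  rw [two_mul]
  refine le_trans ?_ (add_le_add hA hB)
  rw [← Finset.sum_add_distrib]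
  refine Finset.sum_le_sum fun p _ => ?_
  obtain ⟨h1, h2⟩ := abs_im_conj_mul_le (f p.2) (f (p.2 + Pi.single p.1 1))
  rw [abs_neg, abs_mul]
  -- The weight `2 m_j + 1` splits evenly between the two endpoints `m` and `m + e_j`.
  have h3 : |2 * (p.2 p.1 : ℝ) + 1| ≤ |(p.2 p.1 : ℝ)| + |(p.2 p.1 : ℝ) + 1| := by
    refine le_trans (le_of_eq ?_) (abs_add_le _ _)
    ring_nf
  refine (mul_le_mul_of_nonneg_right h3 (abs_nonneg _)).trans ?_
  rw [add_mul, mul_assoc, mul_assoc]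
  exact add_le_add (mul_le_mul_of_nonneg_left h1 (abs_nonneg _))
    (mul_le_mul_of_nonneg_left h2 (abs_nonneg _))

end

/-! ### The discrete Ladyzhenskaya inequality in dimensions two and three -/

theorem abs_le_sum_abs_forwardDiff {N : ℤ} {u : ℤ → ℝ}
    (hu : ∀ n, u n ≠ 0 → -N < n ∧ n < N) (n : ℤ) :
    |u n| ≤ ∑ k ∈ Finset.Icc (-N) N, |u (k + 1) - u k| := by
  by_cases h0 : u n = 0
  · rw [h0, abs_zero]; positivity
  obtain ⟨h1, h2⟩ := hu n h0
  obtain ⟨i, hi⟩ : ∃ i : ℕ, n = -N + i := ⟨(n + N).toNat, by omega⟩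
  have hN : u (-N) = 0 := by
    by_contra h; exact absurd (hu _ h).1 (lt_irrefl _)
  have htel : u n = ∑ k ∈ Finset.range i, (u (-N + k + 1) - u (-N + k)) := by
    have := Finset.sum_range_sub (fun k : ℕ => u (-N + k)) i
    simp only [Nat.cast_add, Nat.cast_one, Nat.cast_zero, add_zero, hN, sub_zero] at this
    rw [hi, ← this]
    simp only [add_assoc]
  rw [htel]
  refine (Finset.abs_sum_le_sum_abs _ _).trans ?_
  rw [← Finset.sum_image (s := Finset.range i) (g := fun k : ℕ => -N + (k : ℤ))
    (f := fun k => |u (k + 1) - u k|) (fun a _ b _ h => by simpa using h)]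
  refine Finset.sum_le_sum_of_subset_of_nonneg ?_ fun _ _ _ => abs_nonneg _
  intro k hk
  simp only [Finset.mem_image, Finset.mem_range, Finset.mem_Icc] at hk ⊢
  omega

theorem abs_norm_sq_sub_norm_sq_le (a b : ℂ) :
    |‖b‖ ^ 2 - ‖a‖ ^ 2| ≤ ‖b - a‖ * (‖a‖ + ‖b‖) := by
  have : ‖b‖ ^ 2 - ‖a‖ ^ 2 = (‖b‖ - ‖a‖) * (‖a‖ + ‖b‖) := by ring
  rw [this, abs_mul, abs_of_nonneg (by positivity : (0:ℝ) ≤ ‖a‖ + ‖b‖)]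
  exact mul_le_mul_of_nonneg_right (abs_norm_sub_norm_le b a) (by positivity)

theorem norm_sq_le_sum_line {N : ℤ} {f : ℤ → ℂ}
    (hf : ∀ n, f n ≠ 0 → -N < n ∧ n < N) (n : ℤ) :
    ‖f n‖ ^ 2 ≤ ∑ k ∈ Finset.Icc (-N) N, ‖f (k + 1) - f k‖ * (‖f k‖ + ‖f (k + 1)‖) := by
  have := abs_le_sum_abs_forwardDiff (N := N) (u := fun n => ‖f n‖ ^ 2)
    (fun n h => hf n fun h0 => h (by simp [h0])) n
  rw [abs_of_nonneg (by positivity)] at this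
  exact this.trans (Finset.sum_le_sum fun k _ => abs_norm_sq_sub_norm_sq_le _ _)

/-- The Cauchy–Schwarz bound for the products produced by `norm_sq_le_sum_line`; the hypothesis
on `b` holds when `b` is a translate of `a`. -/
theorem sq_sum_mul_add_le {ι : Type*} (s : Finset ι) (g a b : ι → ℝ)
    (hab : ∑ i ∈ s, b i ^ 2 = ∑ i ∈ s, a i ^ 2) :
    (∑ i ∈ s, g i * (a i + b i)) ^ 2 ≤ 4 * (∑ i ∈ s, a i ^ 2) * ∑ i ∈ s, g i ^ 2 := by
  refine (Finset.sum_mul_sq_le_sq_mul_sq s _ _).trans ?_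
  have h : ∑ i ∈ s, (a i + b i) ^ 2 ≤ 4 * ∑ i ∈ s, a i ^ 2 := by
    calc ∑ i ∈ s, (a i + b i) ^ 2 ≤ ∑ i ∈ s, (2 * a i ^ 2 + 2 * b i ^ 2) :=
          Finset.sum_le_sum fun i _ => by nlinarith [sq_nonneg (a i - b i)]
      _ = 4 * ∑ i ∈ s, a i ^ 2 := by
          rw [Finset.sum_add_distrib, ← Finset.mul_sum, ← Finset.mul_sum, hab]; ring
  rw [mul_comm]
  exact mul_le_mul_of_nonneg_right h (by positivity)

theorem sq_sum_forwardDiff_mul_le {d : ℕ} {N : ℤ} {f : (Fin d → ℤ) → ℂ}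
    (hf : SupportedInside N f) (j : Fin d) :
    (∑ m ∈ box d N, ‖forwardDiff f j m‖ * (‖f m‖ + ‖f (m + Pi.single j 1)‖)) ^ 2 ≤
      4 * (∑ m ∈ box d N, ‖f m‖ ^ 2) * ∑ m ∈ box d N, ‖forwardDiff f j m‖ ^ 2 :=
  sq_sum_mul_add_le _ _ _ _
    (sum_box_shift (F := fun m => ‖f m‖ ^ 2) (hf.of_imp fun m h => by simp [h]) j)

theorem sum_box_two {N : ℤ} (F : (Fin 2 → ℤ) → ℝ) :
    ∑ m ∈ box 2 N, F m =
      ∑ a ∈ Finset.Icc (-N) N, ∑ b ∈ Finset.Icc (-N) N, F ![a, b] := by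
  rw [← Finset.sum_product']
  refine Finset.sum_nbij' (fun m => (m 0, m 1)) (fun p => ![p.1, p.2]) ?_ ?_ ?_ ?_ ?_
  · intro m hm
    simp only [Fintype.mem_piFinset] at hm
    simpa only [Finset.mem_product] using ⟨hm 0, hm 1⟩
  · intro p hp
    simp only [Finset.mem_product] at hp
    simp only [Fintype.mem_piFinset, Fin.forall_fin_two]
    exact hp
  · intro m _; ext i; fin_cases i <;> rfl
  · intro p _; rfl
  · intro m _; congr 1; ext i; fin_cases i <;> rfl

theorem sum_box_three {N : ℤ} (F : (Fin 3 → ℤ) → ℝ) :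
    ∑ m ∈ box 3 N, F m =
      ∑ c ∈ Finset.Icc (-N) N, ∑ p ∈ box 2 N, F ![p 0, p 1, c] := by
  rw [← Finset.sum_product']
  refine Finset.sum_nbij' (fun m => (m 2, ![m 0, m 1])) (fun p => ![p.2 0, p.2 1, p.1])
    ?_ ?_ ?_ ?_ ?_
  · intro m hm
    simp only [Fintype.mem_piFinset] at hm
    simp only [Finset.mem_product, Fintype.mem_piFinset, Fin.forall_fin_two]
    exact ⟨hm 2, hm 0, hm 1⟩
  · intro p hp
    simp only [Finset.mem_product, Fintype.mem_piFinset] at hp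
    simp only [Fintype.mem_piFinset, Fin.forall_fin_succ, IsEmpty.forall_iff, and_true]
    exact ⟨hp.2 0, hp.2 1, hp.1⟩
  · intro m _; ext i; fin_cases i <;> rfl
  · intro p _
    refine Prod.ext rfl ?_
    ext i; fin_cases i <;> rfl
  · intro m _; congr 1; ext i; fin_cases i <;> rfl

theorem pair_add_single_zero (a b : ℤ) :
    (![a, b] : Fin 2 → ℤ) + Pi.single 0 1 = ![a + 1, b] := by
  ext i; fin_cases i <;> simp

theorem pair_add_single_one (a b : ℤ) :
    (![a, b] : Fin 2 → ℤ) + Pi.single 1 1 = ![a, b + 1] := by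
  ext i; fin_cases i <;> simp

/-- Bound one factor `|f|²` by a sum along the horizontal line and the other by a sum along the
vertical line; the double sum of the product then factorizes. -/
theorem sum_norm_pow_four_le_two {N : ℤ} {f : (Fin 2 → ℤ) → ℂ} (hf : SupportedInside N f) :
    ∑ m ∈ box 2 N, ‖f m‖ ^ 4 ≤ 2 * (∑ m ∈ box 2 N, ‖f m‖ ^ 2) * gradSq N f := by
  set P : Fin 2 → ℝ := fun j =>
    ∑ m ∈ box 2 N, ‖forwardDiff f j m‖ * (‖f m‖ + ‖f (m + Pi.single j 1)‖) with hP
  set g : Fin 2 → (Fin 2 → ℤ) → ℝ := fun j m =>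
    ‖forwardDiff f j m‖ * (‖f m‖ + ‖f (m + Pi.single j 1)‖) with hg
  have h0 : ∀ a b, ‖f ![a, b]‖ ^ 2 ≤ ∑ k ∈ Finset.Icc (-N) N, g 0 ![k, b] := by
    intro a b
    refine (norm_sq_le_sum_line (N := N) (f := fun a => f ![a, b])
      (fun n hn => hf _ hn 0) a).trans (le_of_eq ?_)
    simp only [hg, forwardDiff, pair_add_single_zero]
  have h1 : ∀ a b, ‖f ![a, b]‖ ^ 2 ≤ ∑ k ∈ Finset.Icc (-N) N, g 1 ![a, k] := by
    intro a b
    refine (norm_sq_le_sum_line (N := N) (f := fun b => f ![a, b])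
      (fun n hn => hf _ hn 1) b).trans (le_of_eq ?_)
    simp only [hg, forwardDiff, pair_add_single_one]
  have hQ : ∑ m ∈ box 2 N, ‖f m‖ ^ 4 ≤ P 0 * P 1 := by
    have e0 : P 0 = ∑ b ∈ Finset.Icc (-N) N, ∑ k ∈ Finset.Icc (-N) N, g 0 ![k, b] := by
      rw [Finset.sum_comm]; exact sum_box_two (g 0)
    have e1 : P 1 = ∑ a ∈ Finset.Icc (-N) N, ∑ k ∈ Finset.Icc (-N) N, g 1 ![a, k] :=
      sum_box_two (g 1)
    rw [sum_box_two, e0, e1, mul_comm, Finset.sum_mul_sum]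
    refine Finset.sum_le_sum fun a _ => Finset.sum_le_sum fun b _ => ?_
    calc ‖f ![a, b]‖ ^ 4 = ‖f ![a, b]‖ ^ 2 * ‖f ![a, b]‖ ^ 2 := by ring
      _ ≤ _ := mul_le_mul (h1 a b) (h0 a b) (by positivity)
        ((sq_nonneg _).trans (h1 a b))
  have hP0 := sq_sum_forwardDiff_mul_le hf 0
  have hP1 := sq_sum_forwardDiff_mul_le hf 1
  rw [gradSq, Fin.sum_univ_two]
  have : P 0 * P 1 ≤ (P 0 ^ 2 + P 1 ^ 2) / 2 := by nlinarith [sq_nonneg (P 0 - P 1)]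
  linarith

theorem triple_add_single_zero (p : Fin 2 → ℤ) (c : ℤ) :
    (![p 0, p 1, c] : Fin 3 → ℤ) + Pi.single 0 1 =
      ![(p + Pi.single 0 1 : Fin 2 → ℤ) 0, (p + Pi.single 0 1 : Fin 2 → ℤ) 1, c] := by
  ext i; fin_cases i <;> simp

theorem triple_add_single_one (p : Fin 2 → ℤ) (c : ℤ) :
    (![p 0, p 1, c] : Fin 3 → ℤ) + Pi.single 1 1 =
      ![(p + Pi.single 1 1 : Fin 2 → ℤ) 0, (p + Pi.single 1 1 : Fin 2 → ℤ) 1, c] := by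
  ext i; fin_cases i <;> simp

theorem triple_add_single_two (p : Fin 2 → ℤ) (c : ℤ) :
    (![p 0, p 1, c] : Fin 3 → ℤ) + Pi.single 2 1 = ![p 0, p 1, c + 1] := by
  ext i; fin_cases i <;> simp

/-- Apply the two-dimensional inequality on the slices `m_3 = c`, and bound the mass of every
slice by a sum along lines in the third direction. -/
theorem sq_sum_norm_pow_four_le_three {N : ℤ} {f : (Fin 3 → ℤ) → ℂ}
    (hf : SupportedInside N f) :
    (∑ m ∈ box 3 N, ‖f m‖ ^ 4) ^ 2 ≤
      16 * (∑ m ∈ box 3 N, ‖f m‖ ^ 2) * gradSq N f ^ 3 := by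
  set M := ∑ m ∈ box 3 N, ‖f m‖ ^ 2 with hM
  set T : Fin 3 → ℝ := fun j => ∑ m ∈ box 3 N, ‖forwardDiff f j m‖ ^ 2 with hT
  have hT0 : ∀ j, 0 ≤ T j := fun j => by simp only [hT]; positivity
  have hgrad : gradSq N f = T 0 + T 1 + T 2 := by rw [gradSq, Fin.sum_univ_three]
  set P : ℝ := ∑ m ∈ box 3 N, ‖forwardDiff f 2 m‖ * (‖f m‖ + ‖f (m + Pi.single 2 1)‖) with hP
  have hP0 : 0 ≤ P := by positivity
  have hP2 : P ^ 2 ≤ 4 * M * T 2 := sq_sum_forwardDiff_mul_le hf 2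
  set s : ℤ → (Fin 2 → ℤ) → ℂ := fun c p => f ![p 0, p 1, c] with hs
  have hsupp : ∀ c, SupportedInside N (s c) := by
    intro c p hp
    have := hf _ hp
    rw [Fin.forall_fin_two]
    exact ⟨this 0, this 1⟩
  have hslice : ∀ c, ∑ p ∈ box 2 N, ‖s c p‖ ^ 2 ≤ P := by
    intro c
    rw [hP, sum_box_three, Finset.sum_comm]
    refine Finset.sum_le_sum fun p _ => ?_
    refine (norm_sq_le_sum_line (N := N) (f := fun c => s c p)
      (fun n hn => hf _ hn 2) c).trans (le_of_eq ?_)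
    simp only [hs, forwardDiff, triple_add_single_two]
  have hgs : ∑ c ∈ Finset.Icc (-N) N, gradSq N (s c) = T 0 + T 1 := by
    simp only [gradSq, Fin.sum_univ_two, Finset.sum_add_distrib, hT]
    rw [sum_box_three, sum_box_three]
    simp only [hs, forwardDiff, triple_add_single_zero, triple_add_single_one]
  have hQ : ∑ m ∈ box 3 N, ‖f m‖ ^ 4 ≤ 2 * P * gradSq N f := by
    rw [sum_box_three]
    calc _ ≤ ∑ c ∈ Finset.Icc (-N) N, 2 * P * gradSq N (s c) := by
          refine Finset.sum_le_sum fun c _ => ?_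
          refine (sum_norm_pow_four_le_two (hsupp c)).trans ?_
          exact mul_le_mul_of_nonneg_right (by linarith [hslice c]) (gradSq_nonneg _)
      _ = 2 * P * (T 0 + T 1) := by rw [← Finset.mul_sum, hgs]
      _ ≤ _ := mul_le_mul_of_nonneg_left (by linarith [hT0 2]) (by positivity)
  have hG := gradSq_nonneg (N := N) f
  calc _ ≤ (2 * P * gradSq N f) ^ 2 := by gcongr
    _ = 4 * P ^ 2 * gradSq N f ^ 2 := by ring
    _ ≤ 4 * (4 * M * gradSq N f) * gradSq N f ^ 2 := by
        have : T 2 ≤ gradSq N f := by linarith [hT0 0, hT0 1]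
        have hM0 : 0 ≤ M := by positivity
        gcongr
        exact hP2.trans (by gcongr)
    _ = _ := by ring

/-- The inequality `‖f‖_{L⁴}⁴ ≤ 4 ‖f‖_{H¹}⁴` with a constant independent of the mesh size `h`:
in dimensions two and three the powers of `h` balance. -/
theorem sum_norm_pow_four_le {d : ℕ} (hd : d = 2 ∨ d = 3) {N : ℤ} {f : (Fin d → ℤ) → ℂ}
    (hf : SupportedInside N f) {h : ℝ} (hh : 0 < h) :
    h ^ d * ∑ m ∈ box d N, ‖f m‖ ^ 4 ≤
      4 * (h ^ d * (∑ m ∈ box d N, ‖f m‖ ^ 2 + gradSq N f / h ^ 2)) ^ 2 := by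
  have hG := gradSq_nonneg (N := N) f
  have hM : 0 ≤ ∑ m ∈ box d N, ‖f m‖ ^ 2 := by positivity
  rcases hd with rfl | rfl
  · have := sum_norm_pow_four_le_two hf
    generalize ∑ m ∈ box 2 N, ‖f m‖ ^ 2 = M at *
    generalize gradSq N f = G at *
    have e : h ^ 2 * (M + G / h ^ 2) = h ^ 2 * M + G := by field_simp
    rw [e]
    have := mul_le_mul_of_nonneg_left this (sq_nonneg h)
    nlinarith [sq_nonneg (h ^ 2 * M), sq_nonneg G, mul_nonneg (mul_nonneg (sq_nonneg h) hM) hG]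
  · have := sq_sum_norm_pow_four_le_three hf
    generalize ∑ m ∈ box 3 N, ‖f m‖ ^ 2 = M at *
    generalize gradSq N f = G at *
    have e : h ^ 3 * (M + G / h ^ 2) = h ^ 3 * M + h * G := by field_simp
    rw [e]
    refine (pow_le_pow_iff_left₀ (by positivity) (by positivity) two_ne_zero).1 ?_
    calc _ = h ^ 6 * (∑ m ∈ box 3 N, ‖f m‖ ^ 4) ^ 2 := by ring
      _ ≤ h ^ 6 * (16 * M * G ^ 3) := by gcongr
      _ = 16 * ((h ^ 3 * M) * (h * G) ^ 3) := by ring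
      _ ≤ 16 * ((h ^ 3 * M + h * G) * (h ^ 3 * M + h * G) ^ 3) := by
          have h1 : 0 ≤ h ^ 3 * M := by positivity
          have h2 : 0 ≤ h * G := by positivity
          gcongr <;> linarith
      _ = _ := by ring

/-! ### Functions in `L²(Ω)` as functions on the integer lattice -/

section

variable {d K R : ℕ}

theorem mesh_pos (hK : 0 < K) : 0 < mesh K :=
  div_pos Real.pi_pos (Nat.cast_pos.2 hK)

theorem extend_coe (f : L2 d K R) (x : Omega d K R) : extend f x.1 = f x := by
  simp [extend, x.2]

theorem extend_of_not_interior (f : L2 d K R) (m : Fin d → ℤ)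
    (hm : ¬ ∀ j, -((K : ℤ) * R) < m j ∧ m j < (K : ℤ) * R) : extend f m = 0 := by
  unfold extend
  split_ifs with h
  · refine f.2 ⟨m, h⟩ ?_
    push Not at hm
    obtain ⟨j, hj⟩ := hm
    have := Finset.mem_Icc.1 (Fintype.mem_piFinset.1 h j)
    by_cases h1 : -((K : ℤ) * R) < m j
    · exact ⟨j, Or.inl (le_antisymm this.2 (hj h1))⟩
    · exact ⟨j, Or.inr (le_antisymm (not_lt.1 h1) this.1)⟩
  · rfl

theorem supportedInside_extend (f : L2 d K R) : SupportedInside ((K : ℤ) * R) (extend f) :=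
  fun m hm => by
    by_contra h
    exact hm (extend_of_not_interior f m h)

theorem sum_Omega {E : Type*} [AddCommMonoid E] (F : (Fin d → ℤ) → E) :
    ∑ x : Omega d K R, F x.1 = ∑ m ∈ box d ((K : ℤ) * R), F m :=
  Finset.sum_coe_sort (indexSet d K R) F

theorem extend_laplacian (f : L2 d K R) (m : Fin d → ℤ)
    (hm : ∀ j, -((K : ℤ) * R) < m j ∧ m j < (K : ℤ) * R) :
    extend (laplacian d K R f) m =
      (1 / ((mesh K : ℝ) : ℂ) ^ 2) * ∑ j, secondDiff (extend f) j m := by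
  have hmem : m ∈ indexSet d K R := Fintype.mem_piFinset.2 fun j =>
    Finset.mem_Icc.2 ⟨(hm j).1.le, (hm j).2.le⟩
  have hb : ¬ IsBoundary (⟨m, hmem⟩ : Omega d K R) := by
    rintro ⟨j, h | h⟩
    · exact (hm j).2.ne h
    · exact (hm j).1.ne' h
  have h1 : extend (laplacian d K R f) m = laplacianFun f ⟨m, hmem⟩ :=
    extend_coe (laplacian d K R f) ⟨m, hmem⟩
  rw [h1, laplacianFun, if_neg hb]
  simp only [secondDiff, ← extend_coe]

open ComplexConjugate in
theorem inner_eq_sum (f g : L2 d K R) :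
    inner ℂ f g = ∑ m ∈ box d ((K : ℤ) * R), conj (extend f m) * extend g m := by
  rw [← sum_Omega]
  simp only [extend_coe]
  change inner ℂ f.1 g.1 = _
  rw [PiLp.inner_apply]
  exact Finset.sum_congr rfl fun x _ => by rw [RCLike.inner_apply, mul_comm]

open ComplexConjugate in
theorem inner_laplacian (f g : L2 d K R) :
    inner ℂ f (laplacian d K R g) = -((1 / ((mesh K : ℝ) : ℂ) ^ 2) *
      ∑ j, ∑ m ∈ box d ((K : ℤ) * R),
        conj (forwardDiff (extend f) j m) * forwardDiff (extend g) j m) := by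
  have h : ∀ m, conj (extend f m) * extend (laplacian d K R g) m =
      (1 / ((mesh K : ℝ) : ℂ) ^ 2) * ∑ j, conj (extend f m) * secondDiff (extend g) j m := by
    intro m
    by_cases hm : ∀ j, -((K : ℤ) * R) < m j ∧ m j < (K : ℤ) * R
    · rw [extend_laplacian g m hm, ← Finset.mul_sum]; ring
    · simp [extend_of_not_interior f m hm]
  rw [inner_eq_sum]
  simp only [h]
  rw [← Finset.mul_sum, Finset.sum_comm, ← mul_neg, ← Finset.sum_neg_distrib]
  congr 1
  exact Finset.sum_congr rfl fun j _ => sum_conj_mul_secondDiff (supportedInside_extend f) j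

theorem inner_laplacian_self (f : L2 d K R) :
    inner ℂ f (laplacian d K R f) =
      ((-(gradSq ((K : ℤ) * R) (extend f) / mesh K ^ 2) : ℝ) : ℂ) := by
  rw [inner_laplacian]
  simp only [Complex.conj_mul', gradSq]
  push_cast
  ring

theorem isPositive_one_sub_laplacian :
    (1 - laplacian d K R : L2 d K R →L[ℂ] L2 d K R).IsPositive := by
  refine ⟨?_, ?_⟩
  · intro f g
    have h : inner ℂ (laplacian d K R f) g = inner ℂ f (laplacian d K R g) := by
      rw [← inner_conj_symm, inner_laplacian, inner_laplacian]
      simp only [map_neg, map_mul, map_sum, map_div₀, map_one, map_pow, Complex.conj_ofReal,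
        Complex.conj_conj]
      simp only [mul_comm]
    simp only [ContinuousLinearMap.toLinearMap_sub, ContinuousLinearMap.coe_coe,
      LinearMap.sub_apply, inner_sub_left, inner_sub_right, h]
    rfl
  · intro f
    rw [ContinuousLinearMap.reApplyInnerSelf_apply, inner_re_symm]
    have hg := gradSq_nonneg (N := (K : ℤ) * R) (extend f)
    simp only [sub_apply, one_apply_eq_self, inner_sub_right,
      inner_laplacian_self, map_sub, inner_self_eq_norm_sq, RCLike.re_to_complex,
      Complex.ofReal_re]
    have : 0 ≤ gradSq ((K : ℤ) * R) (extend f) / mesh K ^ 2 := by positivity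
    nlinarith [sq_nonneg ‖f‖]

theorem norm_sq_eq_sum (f : L2 d K R) :
    ‖f‖ ^ 2 = ∑ m ∈ box d ((K : ℤ) * R), ‖extend f m‖ ^ 2 := by
  have h := inner_self_eq_norm_sq_to_K (𝕜 := ℂ) f
  rw [inner_eq_sum] at h
  simp only [Complex.conj_mul'] at h
  apply Complex.ofReal_injective
  rw [Complex.ofReal_sum, Complex.ofReal_pow]
  simp only [Complex.ofReal_pow]
  exact h.symm

/-- The functional calculus enters only through `‖(1 - Δ)^{1/2} f‖² = ⟨f, (1 - Δ) f⟩`. -/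
theorem norm_sqrtOneSubLaplacian_sq (f : L2 d K R) :
    ‖sqrtOneSubLaplacian d K R f‖ ^ 2 =
      ‖f‖ ^ 2 + gradSq ((K : ℤ) * R) (extend f) / mesh K ^ 2 := by
  have hpos : (0 : L2 d K R →L[ℂ] L2 d K R) ≤ 1 - laplacian d K R :=
    (ContinuousLinearMap.nonneg_iff_isPositive _).2 isPositive_one_sub_laplacian
  have hsq : sqrtOneSubLaplacian d K R * sqrtOneSubLaplacian d K R = 1 - laplacian d K R :=
    CFC.sqrt_mul_sqrt_self _ hpos
  have hsa : (sqrtOneSubLaplacian d K R).IsPositive :=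
    (ContinuousLinearMap.nonneg_iff_isPositive _).1 (CFC.sqrt_nonneg _)
  have h1 : inner ℂ (sqrtOneSubLaplacian d K R f) (sqrtOneSubLaplacian d K R f) =
      inner ℂ f ((1 - laplacian d K R) f) := by
    rw [← hsq]
    exact hsa.isSymmetric f _
  have h2 := congrArg Complex.re h1
  rw [sub_apply, inner_sub_right, inner_laplacian_self,
    one_apply_eq_self, Complex.sub_re, Complex.ofReal_re] at h2
  have h3 := inner_self_eq_norm_sq (𝕜 := ℂ) f
  have h4 := inner_self_eq_norm_sq (𝕜 := ℂ) (sqrtOneSubLaplacian d K R f)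
  simp only [RCLike.re_to_complex] at h3 h4
  linarith

theorem l2Norm_sq (f : L2 d K R) : l2Norm f ^ 2 = mesh K ^ d * ‖f‖ ^ 2 := by
  have hm : 0 ≤ mesh K := by unfold mesh; positivity
  rw [l2Norm, Real.sq_sqrt (by positivity), norm_sq_eq_sum, ← sum_Omega]
  simp only [extend_coe]

theorem h1Norm_sq (f : L2 d K R) :
    h1Norm f ^ 2 = mesh K ^ d * (∑ m ∈ box d ((K : ℤ) * R), ‖extend f m‖ ^ 2 +
      gradSq ((K : ℤ) * R) (extend f) / mesh K ^ 2) := by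
  rw [h1Norm, l2Norm_sq, norm_sqrtOneSubLaplacian_sq, norm_sq_eq_sum]

theorem weightedL2Norm_eq (f : L2 d K R) :
    weightedL2Norm f =
      √(mesh K ^ d * (mesh K ^ 2 * momentSq ((K : ℤ) * R) (extend f))) := by
  rw [weightedL2Norm, momentSq, ← sum_Omega (K := K) (R := R)
    fun m => (∑ j, (m j : ℝ) ^ 2) * ‖extend f m‖ ^ 2]
  simp only [extend_coe]
  congr 2
  rw [Finset.mul_sum]
  refine Finset.sum_congr rfl fun x _ => ?_
  rw [mul_pow, EuclideanSpace.norm_sq_eq, ← mul_assoc, Finset.mul_sum]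
  simp [point, mul_pow]

theorem h1Norm_le_h11Norm (f : L2 d K R) : h1Norm f ≤ h11Norm f :=
  Real.le_sqrt_of_sq_le (by nlinarith [sq_nonneg (weightedL2Norm f)])

theorem weightedL2Norm_le_h11Norm (f : L2 d K R) : weightedL2Norm f ≤ h11Norm f :=
  Real.le_sqrt_of_sq_le (by nlinarith [sq_nonneg (h1Norm f)])

/-! ### Conservation of energy and growth of the moment -/

/-- Evaluation of the zero extension at `m`, as a continuous real-linear map. -/
def extendCLM (m : Fin d → ℤ) : L2 d K R →L[ℝ] ℂ :=
  ContinuousLinearMap.restrictScalars ℝ (LinearMap.toContinuousLinearMap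
    { toFun := fun f => extend f m
      map_add' := fun f g => extend_add f g m
      map_smul' := fun a f => extend_smul a f m } : L2 d K R →L[ℂ] ℂ)

theorem hasDerivAt_extend {w : ℝ → L2 d K R} (hw : Differentiable ℝ w) (t : ℝ)
    (m : Fin d → ℤ) :
    HasDerivAt (fun s => extend (w s) m) (extend (deriv w t) m) t :=
  ((extendCLM m).hasFDerivAt (x := w t)).comp_hasDerivAt t (hw t).hasDerivAt

theorem hasDerivAt_forwardDiff {w : ℝ → L2 d K R} (hw : Differentiable ℝ w) (t : ℝ)
    (j : Fin d) (m : Fin d → ℤ) :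
    HasDerivAt (fun s => forwardDiff (extend (w s)) j m)
      (forwardDiff (extend (deriv w t)) j m) t :=
  (hasDerivAt_extend hw t _).sub (hasDerivAt_extend hw t m)

open ComplexConjugate in
theorem hasDerivAt_norm_sq {z : ℝ → ℂ} {z' : ℂ} {t : ℝ} (h : HasDerivAt z z' t) :
    HasDerivAt (fun s => ‖z s‖ ^ 2) (2 * (conj z' * z t).re) t := by
  have := h.norm_sq
  rwa [Complex.inner, ← Complex.conj_re, map_mul, Complex.conj_conj] at this

/-- Twice the conserved energy `½ ‖∇f‖² + ¼ ‖f‖_{L⁴}⁴`, without the factor `h^d`. -/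
def energy (f : L2 d K R) : ℝ :=
  gradSq ((K : ℤ) * R) (extend f) / mesh K ^ 2 +
    1 / 2 * ∑ m ∈ box d ((K : ℤ) * R), ‖extend f m‖ ^ 4

theorem IsGlobalSolution.extend_deriv {w₀ : L2 d K R} {w : ℝ → L2 d K R}
    (hw : IsGlobalSolution w₀ w) (t : ℝ) (m : Fin d → ℤ)
    (hm : ∀ j, -((K : ℤ) * R) < m j ∧ m j < (K : ℤ) * R) :
    Complex.I * extend (deriv w t) m + (1 / ((mesh K : ℝ) : ℂ) ^ 2) *
      ∑ j, secondDiff (extend (w t)) j m -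
        ((‖extend (w t) m‖ ^ 2 : ℝ) : ℂ) * extend (w t) m = 0 := by
  have hmem : m ∈ indexSet d K R := Fintype.mem_piFinset.2 fun j =>
    Finset.mem_Icc.2 ⟨(hm j).1.le, (hm j).2.le⟩
  have h := hw.equation t ⟨m, hmem⟩
  simp only [← extend_coe] at h
  rwa [extend_laplacian _ _ hm] at h

open ComplexConjugate in
theorem IsGlobalSolution.energy_eq {w₀ : L2 d K R} {w : ℝ → L2 d K R}
    (hw : IsGlobalSolution w₀ w) (t : ℝ) : energy (w t) = energy w₀ := by
  have hderiv : ∀ t, HasDerivAt (fun s => energy (w s)) 0 t := by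
    intro t
    have h1 : HasDerivAt (fun s => gradSq ((K : ℤ) * R) (extend (w s)))
        (∑ j, ∑ m ∈ box d ((K : ℤ) * R), 2 * (conj (forwardDiff (extend (deriv w t)) j m) *
          forwardDiff (extend (w t)) j m).re) t :=
      HasDerivAt.fun_sum fun j _ => HasDerivAt.fun_sum fun m _ =>
        hasDerivAt_norm_sq (hasDerivAt_forwardDiff hw.differentiable t j m)
    have h2 : HasDerivAt (fun s => ∑ m ∈ box d ((K : ℤ) * R), ‖extend (w s) m‖ ^ 4)
        (∑ m ∈ box d ((K : ℤ) * R), 4 * ‖extend (w t) m‖ ^ 2 *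
          (conj (extend (deriv w t) m) * extend (w t) m).re) t := by
      refine HasDerivAt.fun_sum fun m _ => ?_
      have h := (hasDerivAt_norm_sq (hasDerivAt_extend hw.differentiable t m)).fun_pow 2
      simp only [← pow_mul, Nat.reduceMul] at h
      exact h.congr_deriv (by push_cast; ring)
    refine ((h1.div_const (mesh K ^ 2)).add (h2.const_mul (1 / 2))).congr_deriv ?_
    -- The derivative is `-2 Re ⟨w', Δw - |w|²w⟩`, and `Δw - |w|²w = -i w'`.
    have h3 : ∑ j, ∑ m ∈ box d ((K : ℤ) * R), 2 * (conj (forwardDiff (extend (deriv w t)) j m) *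
          forwardDiff (extend (w t)) j m).re =
        -(2 * ∑ m ∈ box d ((K : ℤ) * R),
          (conj (extend (deriv w t) m) * ∑ j, secondDiff (extend (w t)) j m).re) := by
      simp only [Finset.mul_sum, Complex.re_sum]
      rw [Finset.sum_comm (s := box d ((K : ℤ) * R)), ← Finset.sum_neg_distrib]
      refine Finset.sum_congr rfl fun j _ => ?_
      rw [← Finset.mul_sum, ← Finset.mul_sum, ← mul_neg, ← Complex.re_sum, ← Complex.re_sum,
        sum_conj_mul_secondDiff (supportedInside_extend _), Complex.neg_re, neg_neg]
    rw [h3, Finset.mul_sum, Finset.mul_sum, ← Finset.sum_neg_distrib, Finset.sum_div,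
      ← Finset.sum_add_distrib]
    refine Finset.sum_eq_zero fun m _ => ?_
    by_cases hm : ∀ j, -((K : ℤ) * R) < m j ∧ m j < (K : ℤ) * R
    · have h := hw.extend_deriv t m hm
      generalize extend (deriv w t) m = u at *
      generalize extend (w t) m = v at *
      generalize ∑ j, secondDiff (extend (w t)) j m = S at *
      have h4 : (conj u * (Complex.I * u + (1 / ((mesh K : ℝ) : ℂ) ^ 2) * S -
          ((‖v‖ ^ 2 : ℝ) : ℂ) * v)).re =
          (conj u * S).re / mesh K ^ 2 - ‖v‖ ^ 2 * (conj u * v).re := by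
        have e : conj u * (Complex.I * u + (1 / ((mesh K : ℝ) : ℂ) ^ 2) * S -
            ((‖v‖ ^ 2 : ℝ) : ℂ) * v) = Complex.I * ((‖u‖ ^ 2 : ℝ) : ℂ) +
            (((mesh K ^ 2)⁻¹ : ℝ) : ℂ) * (conj u * S) - ((‖v‖ ^ 2 : ℝ) : ℂ) * (conj u * v) := by
          push_cast
          rw [← Complex.conj_mul' u]
          ring
        rw [e, Complex.sub_re, Complex.add_re, Complex.re_ofReal_mul, Complex.re_ofReal_mul,
          Complex.re_mul_ofReal]
        simp; ring
      rw [h] at h4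
      simp only [mul_zero, Complex.zero_re] at h4
      linear_combination (2 : ℝ) * h4
    · simp [extend_of_not_interior _ m hm]
  have := is_const_of_deriv_eq_zero (fun s => (hderiv s).differentiableAt)
    (fun s => (hderiv s).deriv) t 0
  rw [this, hw.initial]

open ComplexConjugate in
theorem IsGlobalSolution.hasDerivAt_momentSq {w₀ : L2 d K R} {w : ℝ → L2 d K R}
    (hw : IsGlobalSolution w₀ w) (t : ℝ) :
    HasDerivAt (fun s => momentSq ((K : ℤ) * R) (extend (w s)))
      (-(2 / mesh K ^ 2 * (∑ m ∈ box d ((K : ℤ) * R), ((∑ i, (m i : ℝ) ^ 2 : ℝ) : ℂ) *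
        (conj (extend (w t) m) * ∑ j, secondDiff (extend (w t)) j m)).im)) t := by
  have h1 : HasDerivAt (fun s => momentSq ((K : ℤ) * R) (extend (w s)))
      (∑ m ∈ box d ((K : ℤ) * R), (∑ i, (m i : ℝ) ^ 2) *
        (2 * (conj (extend (deriv w t) m) * extend (w t) m).re)) t :=
    HasDerivAt.fun_sum fun m _ =>
      (hasDerivAt_norm_sq (hasDerivAt_extend hw.differentiable t m)).const_mul _
  refine h1.congr_deriv ?_
  rw [Complex.im_sum, Finset.mul_sum, ← Finset.sum_neg_distrib]
  refine Finset.sum_congr rfl fun m _ => ?_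
  rw [Complex.im_ofReal_mul]
  by_cases hm : ∀ j, -((K : ℤ) * R) < m j ∧ m j < (K : ℤ) * R
  · have h := hw.extend_deriv t m hm
    generalize extend (deriv w t) m = u at *
    generalize extend (w t) m = v at *
    generalize ∑ j, secondDiff (extend (w t)) j m = S at *
    have h4 : (conj v * (Complex.I * u + (1 / ((mesh K : ℝ) : ℂ) ^ 2) * S -
        ((‖v‖ ^ 2 : ℝ) : ℂ) * v)).im =
        (conj u * v).re + (conj v * S).im / mesh K ^ 2 := by
      have e : conj v * (Complex.I * u + (1 / ((mesh K : ℝ) : ℂ) ^ 2) * S -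
          ((‖v‖ ^ 2 : ℝ) : ℂ) * v) = Complex.I * (conj v * u) +
          (((mesh K ^ 2)⁻¹ : ℝ) : ℂ) * (conj v * S) - ((‖v‖ ^ 4 : ℝ) : ℂ) := by
        push_cast
        have : (‖v‖ : ℂ) ^ 4 = (‖v‖ : ℂ) ^ 2 * (conj v * v) := by
          rw [Complex.conj_mul']; ring
        rw [this]
        ring
      rw [e, Complex.sub_im, Complex.add_im, Complex.im_ofReal_mul, Complex.ofReal_im]
      simp; ring
    rw [h] at h4
    simp only [mul_zero, Complex.zero_im] at h4
    linear_combination (-2 : ℝ) * (∑ i, (m i : ℝ) ^ 2) * h4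
  · simp [extend_of_not_interior _ m hm]

/-- A nonnegative function with `|y'| ≤ 2 B √y` satisfies `√y(t) ≤ √y(0) + B |t|`. -/
theorem sqrt_le_add_mul_abs {y y' : ℝ → ℝ} {B : ℝ} (hy : ∀ t, HasDerivAt y (y' t) t)
    (hy0 : ∀ t, 0 ≤ y t) (hB : 0 ≤ B) (hbound : ∀ t, |y' t| ≤ 2 * B * √(y t)) (t : ℝ) :
    √(y t) ≤ √(y 0) + B * |t| := by
  -- The square root is differentiable only away from zero, so `y` is replaced by `y + ε²`.
  have key : ∀ ε : ℝ, 0 < ε → √(y t) ≤ √(y 0) + B * |t| + ε := by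
    intro ε hε
    have hpos : ∀ s, 0 < y s + ε ^ 2 := fun s => by have := hy0 s; positivity
    have hd : ∀ s ∈ (Set.univ : Set ℝ), HasDerivWithinAt (fun s => √(y s + ε ^ 2))
        (y' s / (2 * √(y s + ε ^ 2))) Set.univ s := fun s _ =>
      (((hy s).add_const (ε ^ 2)).sqrt (hpos s).ne').hasDerivWithinAt
    have hb : ∀ s ∈ (Set.univ : Set ℝ), ‖y' s / (2 * √(y s + ε ^ 2))‖ ≤ B := by
      intro s _
      have h1 : 0 < √(y s + ε ^ 2) := Real.sqrt_pos.2 (hpos s)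
      rw [Real.norm_eq_abs, abs_div, abs_of_pos (by positivity : 0 < 2 * √(y s + ε ^ 2)),
        div_le_iff₀ (by positivity)]
      refine (hbound s).trans ?_
      have h2 : √(y s) ≤ √(y s + ε ^ 2) := Real.sqrt_le_sqrt (by nlinarith)
      nlinarith
    have h := convex_univ.norm_image_sub_le_of_norm_hasDerivWithin_le hd hb
      (Set.mem_univ 0) (Set.mem_univ t)
    rw [Real.norm_eq_abs, Real.norm_eq_abs, sub_zero] at h
    have h1 : √(y t) ≤ √(y t + ε ^ 2) := Real.sqrt_le_sqrt (by nlinarith)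
    have h2 : √(y 0 + ε ^ 2) ≤ √(y 0) + ε := by
      refine Real.sqrt_le_iff.2 ⟨by positivity, ?_⟩
      nlinarith [Real.sq_sqrt (hy0 0), Real.sqrt_nonneg (y 0)]
    linarith [le_abs_self (√(y t + ε ^ 2) - √(y 0 + ε ^ 2))]
  exact le_of_forall_pos_le_add key

/-- The conserved energy is controlled by the `H¹` norm, uniformly in the mesh size. -/
theorem mesh_mul_energy_le (hd : d = 2 ∨ d = 3) (hK : 0 < K) (f : L2 d K R) :
    mesh K ^ d * energy f ≤ (h1Norm f + 2 * h1Norm f ^ 2) ^ 2 := by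
  have hh := mesh_pos hK
  have hS := sum_norm_pow_four_le hd (supportedInside_extend f) hh
  rw [← h1Norm_sq] at hS
  have h0 : 0 ≤ h1Norm f := Real.sqrt_nonneg _
  have h1 : mesh K ^ d * (gradSq ((K : ℤ) * R) (extend f) / mesh K ^ 2) ≤ h1Norm f ^ 2 := by
    rw [h1Norm_sq]
    gcongr
    exact le_add_of_nonneg_left (by positivity)
  rw [energy]
  nlinarith [pow_nonneg h0 3, pow_nonneg h0 4]

theorem IsGlobalSolution.weightedL2Norm_le {w₀ : L2 d K R} {w : ℝ → L2 d K R}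
    (hw : IsGlobalSolution w₀ w) (hd : d = 2 ∨ d = 3) (hK : 0 < K) (t : ℝ) :
    weightedL2Norm (w t) ≤
      weightedL2Norm w₀ + 2 * (h1Norm w₀ + 2 * h1Norm w₀ ^ 2) * |t| := by
  have hh := mesh_pos hK
  have hH : 0 ≤ h1Norm w₀ := Real.sqrt_nonneg _
  set B := h1Norm w₀ + 2 * h1Norm w₀ ^ 2 with hB
  have hB0 : 0 ≤ B := by positivity
  have hgrad : ∀ s, √(mesh K ^ d * (gradSq ((K : ℤ) * R) (extend (w s)) / mesh K ^ 2)) ≤ B := by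
    intro s
    refine Real.sqrt_le_iff.2 ⟨hB0, ?_⟩
    refine le_trans ?_ (mesh_mul_energy_le hd hK w₀)
    rw [← hw.energy_eq s, energy]
    gcongr
    exact le_add_of_nonneg_right (by positivity)
  have hy : ∀ s, HasDerivAt
      (fun s => mesh K ^ d * (mesh K ^ 2 * momentSq ((K : ℤ) * R) (extend (w s)))) _ s :=
    fun s => ((hw.hasDerivAt_momentSq s).const_mul (mesh K ^ 2)).const_mul (mesh K ^ d)
  have hmain := sqrt_le_add_mul_abs (B := 2 * B) hy
    (fun s => by have := momentSq_nonneg (N := (K : ℤ) * R) (extend (w s)); positivity)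
    (by positivity) ?_ t
  · rw [weightedL2Norm_eq, weightedL2Norm_eq w₀]
    rwa [hw.initial] at hmain
  intro s
  have him := abs_im_sum_weight_laplacian_le (supportedInside_extend (w s))
  set J := (∑ m ∈ box d ((K : ℤ) * R), _ : ℂ).im
  set V := momentSq ((K : ℤ) * R) (extend (w s))
  set G := gradSq ((K : ℤ) * R) (extend (w s)) with hG
  have hg := hgrad s
  have e1 : √(mesh K ^ d * (mesh K ^ 2 * V)) = √(mesh K ^ d) * (mesh K * √V) := by
    rw [Real.sqrt_mul (by positivity), Real.sqrt_mul (by positivity), Real.sqrt_sq hh.le]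
  have e2 : √(mesh K ^ d * (G / mesh K ^ 2)) = √(mesh K ^ d) * (√G / mesh K) := by
    rw [Real.sqrt_mul (by positivity), Real.sqrt_div (gradSq_nonneg _), Real.sqrt_sq hh.le]
  have e3 : √(mesh K ^ d) * √(mesh K ^ d) = mesh K ^ d := Real.mul_self_sqrt (by positivity)
  calc |mesh K ^ d * (mesh K ^ 2 * -(2 / mesh K ^ 2 * J))| = 2 * mesh K ^ d * |J| := by
        have : mesh K ^ d * (mesh K ^ 2 * -(2 / mesh K ^ 2 * J)) = -(2 * mesh K ^ d * J) := by
          field_simp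
        rw [this, abs_neg, abs_mul, abs_of_pos (by positivity)]
    _ ≤ 2 * mesh K ^ d * (2 * (√V * √G)) := by gcongr
    _ = 4 * √(mesh K ^ d * (G / mesh K ^ 2)) * √(mesh K ^ d * (mesh K ^ 2 * V)) := by
        have e4 : √G / mesh K * (mesh K * √V) = √G * √V := by field_simp
        rw [e1, e2]
        linear_combination (-4 * √V * √G) * e3 - 4 * (√(mesh K ^ d) * √(mesh K ^ d)) * e4
    _ ≤ 4 * B * √(mesh K ^ d * (mesh K ^ 2 * V)) := by gcongr
    _ = _ := by ring

end

end LatticeNLS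

end

theorem mainTheorem3 :
    ∃ c : ℝ → ℝ, (∀ N : ℝ, 0 < c N) ∧
      ∀ d : ℕ, (d = 2 ∨ d = 3) → ∀ α : ℝ, 0 < α → ∀ A : ℝ, 1 ≤ A →
        ∃ C : ℝ, 0 < C ∧
          ∀ K R : ℕ, 0 < K → LatticeNLS.mesh K ≤ 1 →
            A⁻¹ * LatticeNLS.mesh K ^ (-α) ≤ (R : ℝ) →
            (R : ℝ) ≤ A * LatticeNLS.mesh K ^ (-α) →
            ∀ (w₀ : LatticeNLS.L2 d K R) (w : ℝ → LatticeNLS.L2 d K R),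
              LatticeNLS.IsGlobalSolution w₀ w →
              ∀ t : ℝ, LatticeNLS.weightedL2Norm (w t) ≤
                C * LatticeNLS.h11Norm w₀ * Real.exp (c (LatticeNLS.h11Norm w₀) * |t|) := by
  refine ⟨fun N => 1 + |N|, fun N => by positivity, fun d hd α _ A _ => ⟨4, by norm_num, ?_⟩⟩
  intro K R hK _ _ _ w₀ w hw t
  have h1 := hw.weightedL2Norm_le hd hK t
  have hx := LatticeNLS.weightedL2Norm_le_h11Norm w₀
  have hH := LatticeNLS.h1Norm_le_h11Norm w₀
  have hH0 : 0 ≤ LatticeNLS.h1Norm w₀ := Real.sqrt_nonneg _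
  set N := LatticeNLS.h11Norm w₀
  have hN : 0 ≤ N := hH0.trans hH
  simp only [abs_of_nonneg hN]
  have hexp := Real.add_one_le_exp ((1 + N) * |t|)
  calc LatticeNLS.weightedL2Norm (w t) ≤ N + 2 * (N + 2 * N ^ 2) * |t| := by
        refine h1.trans ?_
        gcongr
    _ ≤ 4 * N * ((1 + N) * |t| + 1) := by
        have : 0 ≤ N * |t| := by positivity
        nlinarith
    _ ≤ _ := by gcongr
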